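/- A formal context is a triple $(G,M,I)$ consisting of a set $G$ of objects, a set $M$ of attributes and a relation $I\subseteq G\times M$. For $A\subseteq G$ put $A^I=\{m\in M : (g,m)\in I \text{ for all } g\in A\}$ and for $B\subseteq M$ put $B^I=\{g\in G : (g,m)\in I\text{ for all } m\in B\}$. A concept of $(G,M,I)$ is a pair $(A,B)$ with $A\subseteq G$, $B\subseteq M$, $A^I=B$ and $B^I=A$. A subcontext of $(G,M,I)$ is a context $(H,N,I\cap(H\times N))$ with $H\subseteq G$ and $N\subseteq M$. The contranominal scale of size $j$ is the context $(\{1,\dots,j\},\{1,\dots,j\},\neq)$, and a context is said to have a contranominal scale of size $j$ as a subcontext if one of its subcontexts is isomorphic to it. Theorem. Let $n,m\ge 0$ and $c$ be integers with $1\le c\le\min\{n,m\}+1$. Among the formal contexts with exactly $n$ objects, exactly $m$ attributes and no contranominal scale of size $c$ as a subcontext, there exists one which has the maximum number of concepts (among all such contexts) and which has a contranominal scale of size $c-1$ as a subcontext. -/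

import Mathlib

universe u v u' v'

/-- A formal context `(G, M, I)`: a set of objects, a set of attributes, and an incidence relation
between them. -/
structure FormalContext where
  /-- the objects -/
  Obj : Type u
  /-- the attributes -/
  Att : Type v
  /-- the incidence relation -/
  Inc : Obj → Att → Prop

namespace FormalContext

/-- The number of formal concepts of a context (the cardinality of its concept lattice). It is
used for contexts with finitely many objects and attributes only, which have finitely many
concepts. -/
noncomputable def numConcepts (K : FormalContext.{u, v}) : ℕ :=
  Nat.card (Concept K.Obj K.Att K.Inc)

/-- The subcontext `(H, N, I ∩ (H × N))` of a context `(G, M, I)`, for `H ⊆ G` and `N ⊆ M`. -/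
def sub (K : FormalContext.{u, v}) (H : Set K.Obj) (N : Set K.Att) : FormalContext.{u, v} where
  Obj := H
  Att := N
  Inc := fun g m => K.Inc g.1 m.1

/-- Isomorphisms of contexts: a bijection of the objects and a bijection of the attributes that
together preserve and reflect incidence. -/
structure Iso (K : FormalContext.{u, v}) (L : FormalContext.{u', v'}) where
  /-- the bijection of the objects -/
  objEquiv : K.Obj ≃ L.Obj
  /-- the bijection of the attributes -/
  attEquiv : K.Att ≃ L.Att
  /-- incidence is preserved and reflected -/
  inc_iff : ∀ (g : K.Obj) (m : K.Att), K.Inc g m ↔ L.Inc (objEquiv g) (attEquiv m)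

/-- The contranominal scale of size `j`: `j` objects and `j` attributes, indexed alike, an object
being incident with an attribute if and only if their indices differ. -/
def contranominal (j : ℕ) : FormalContext.{0, 0} where
  Obj := Fin j
  Att := Fin j
  Inc := fun g m => g ≠ m

/-- The context `K` has a contranominal scale of size `j` as a subcontext (up to isomorphism). -/
def HasContranominal (K : FormalContext.{u, v}) (j : ℕ) : Prop :=
  ∃ (H : Set K.Obj) (N : Set K.Att), Nonempty (Iso (K.sub H N) (contranominal j))

/-- The class of contexts with exactly `a` objects, exactly `b` attributes and no contranominal
scale of size `c` as a subcontext. -/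
def contranominalFree (a b c : ℕ) : Set FormalContext.{u, v} :=
  {K | (Finite K.Obj ∧ Nat.card K.Obj = a) ∧ (Finite K.Att ∧ Nat.card K.Att = b) ∧
    ¬ K.HasContranominal c}

/-- The contexts of `contranominalFree a b c` that have the maximum number of concepts among all
contexts of that class. -/
def extremal (a b c : ℕ) : Set FormalContext.{u, v} :=
  {K | K ∈ contranominalFree.{u, v} a b c ∧
    ∀ L ∈ contranominalFree.{u, v} a b c, L.numConcepts ≤ K.numConcepts}

end FormalContext

/-!
The proof is by induction on `c`, and rests on one inequality: every finite context `K` with an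
object and an attribute has an object `g` and an attribute `m` whose removal leaves at least half
of the concepts (`FormalContext.exists_numConcepts_le_two_mul_sub`).

Granting it, let `K` be extremal for scales of size `k + 2`, with `n + 1` objects and `m + 1`
attributes, and suppose that `K` has no contranominal scale of size `k + 1`. Then `K - g - m` is a
context with `n` objects, `m` attributes and no such scale, so it has at most as many concepts as
the context `K₀` which the induction hypothesis gives: extremal for scales of size `k + 1`, with a
scale of size `k`. The direct sum of `K₀` with the contranominal scale of size one
(`FormalContext.extend`) doubles the number of concepts and enlarges the contranominal scales by
exactly one. Hence it has at least as many concepts as `K`, has no scale of size `k + 2`, and has one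
of size `k + 1`.

The inequality is a statement about Moore families (`exists_card_union_le_two_mul_card_image`).
Let `g` be an object that lacks some attribute, `r` its set of attributes, and `L` the family of
the intents of `K - g`. The intents of
`K` are the members of `L` together with the sets `B ∩ r`, and those of `K - g - m` are the sets
`B \ {m}`, where `B` runs over `L`. Let `Y` be the set of the `B ∩ r` that are not in `L`. Call
`B ∈ L` *unmatched* by `m` if toggling `m` in `B` leaves `L`. The attribute `m` is a good choice
as soon as at least `#Y` members of `L` are unmatched by `m`, and such an `m ∉ r` is found by
averaging: `Y × rᶜ` injects into the set of pairs `(B, m)` with `B` unmatched by `m ∉ r`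
(`card_mul_card_le_card_unmatched`).
-/

/-! ### Moore families -/

open Finset in
/-- If each member of `Y` has the form `B ∩ r` with `B ∈ L` but is not itself in the Moore family
`L`, then `Y × rᶜ` injects into the set of pairs `(B, m)` such that `m ∉ r` and toggling `m` in
`B ∈ L` leads out of `L`. -/
theorem card_mul_card_le_card_unmatched {α : Type*} (L Y : Finset (Set α))
    (W : Finset α) (r : Set α) (hW : ∀ a, a ∈ W ↔ a ∉ r)
    (hL : ∀ S : Set (Set α), S ⊆ L → ⋂₀ S ∈ L)
    (hY : ∀ C ∈ Y, C ∉ L ∧ ∃ B ∈ L, B ∩ r = C)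
    [DecidablePred fun p : Set α × α => symmDiff p.1 {p.2} ∉ L] :
    #Y * #W ≤ #{p ∈ L ×ˢ W | symmDiff p.1 {p.2} ∉ L} := by
  classical
  rcases isEmpty_or_nonempty α with _ | _
  · simp [Finset.eq_empty_of_isEmpty W]
  -- `cl C` is the least member of `L` containing `C`; it meets `r` in `C` only, so that it has
  -- an element `s C` outside `r`.
  let cl : Set α → Set α := fun C => ⋂₀ {B | B ∈ L ∧ C ⊆ B}
  have cl_mem : ∀ C, cl C ∈ L := fun C => hL _ fun B hB => hB.1
  have sub_cl : ∀ C, C ⊆ cl C := fun C => Set.subset_sInter fun B hB => hB.2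
  have cl_sub : ∀ {C B}, B ∈ L → C ⊆ B → cl C ⊆ B := fun hB h => Set.sInter_subset_of_mem ⟨hB, h⟩
  have sub_r : ∀ C ∈ Y, C ⊆ r := by
    intro C hC
    obtain ⟨-, B, -, rfl⟩ := hY C hC
    exact Set.inter_subset_right
  have cl_inter : ∀ C ∈ Y, cl C ∩ r = C := by
    intro C hC
    refine Set.Subset.antisymm ?_ (Set.subset_inter (sub_cl C) (sub_r C hC))
    obtain ⟨-, B, hB, rfl⟩ := hY C hC
    exact Set.inter_subset_inter_left r (cl_sub hB Set.inter_subset_left)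
  have exists_s : ∀ C ∈ Y, ∃ s, s ∈ cl C ∧ s ∉ r := by
    intro C hC
    refine Set.not_subset.1 fun h => (hY C hC).1 ?_
    rw [← cl_inter C hC, Set.inter_eq_left.2 h]
    exact cl_mem C
  choose! s hs_mem hs_not using exists_s
  -- If `cl C` is matched by `m` at all, then `cl C ∪ {m}` belongs to `L`, and removing `s C` from
  -- that set leads out of `L` by minimality of `cl C`.
  let f : Set α × α → Set α × α := fun p =>
    if p.2 ∉ cl p.1 ∧ insert p.2 (cl p.1) ∈ L then (insert p.2 (cl p.1), s p.1) else (cl p.1, p.2)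
  rw [← Finset.card_product]
  refine Finset.card_le_card_of_injOn f ?_ ?_
  · rintro ⟨C, m⟩ hp
    obtain ⟨hC, hm⟩ := Finset.mem_product.1 (Finset.mem_coe.1 hp)
    -- No member of `L` contains `C` and omits an element of `cl C`.
    have key : ∀ {B : Set α} {x : α}, x ∈ B → x ∈ cl C → x ∉ r → C ⊆ B →
        symmDiff B {x} ∉ L := by
      intro B x hxB hx hxr hCB hmem
      have hsub : C ⊆ symmDiff B {x} := fun y hy => Or.inl
        ⟨hCB hy, fun h => hxr (Set.mem_singleton_iff.1 h ▸ sub_r C hC hy)⟩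
      have := cl_sub hmem hsub hx
      simp [Set.mem_symmDiff, hxB] at this
    simp only [Finset.coe_filter, Finset.mem_product, Set.mem_ofPred_eq, f]
    split_ifs with h
    · exact ⟨⟨h.2, (hW _).2 (hs_not C hC)⟩, key (Set.mem_insert_of_mem _ (hs_mem C hC))
        (hs_mem C hC) (hs_not C hC) ((sub_cl C).trans (Set.subset_insert _ _))⟩
    · refine ⟨⟨cl_mem C, hm⟩, ?_⟩
      by_cases hmC : m ∈ cl C
      · exact key hmC hmC ((hW m).1 hm) (sub_cl C)
      · have : symmDiff (cl C) {m} = insert m (cl C) := by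
          ext x
          by_cases hx : x = m <;> simp [Set.mem_symmDiff, hx, hmC]
        rw [this]
        exact fun hmem => h ⟨hmC, hmem⟩
  · rintro ⟨C, m⟩ hp ⟨C', m'⟩ hp' heq
    obtain ⟨hC, hm⟩ : C ∈ Y ∧ m ∈ W := Finset.mem_product.1 (Finset.mem_coe.1 hp)
    obtain ⟨hC', hm'⟩ : C' ∈ Y ∧ m' ∈ W := Finset.mem_product.1 (Finset.mem_coe.1 hp')
    rw [hW] at hm hm'
    have insert_inter : ∀ {x : α} {B : Set α}, x ∉ r → insert x B ∩ r = B ∩ r :=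
      fun hx => Set.insert_inter_of_notMem hx
    -- The first component determines `C`, as its intersection with `r`.
    have fst_inter : ∀ {C m}, C ∈ Y → m ∉ r → (f (C, m)).1 ∩ r = C := by
      intro C m hC hm
      simp only [f]
      split_ifs
      · rw [insert_inter hm, cl_inter C hC]
      · exact cl_inter C hC
    obtain rfl : C = C' := by rw [← fst_inter hC hm, heq, fst_inter hC' hm']
    simp only [f] at heq
    split_ifs at heq with h h' h' <;> obtain ⟨h1, h2⟩ := Prod.mk.inj heq
    · have hmem : m ∈ insert m' (cl C) := h1 ▸ Set.mem_insert m (cl C)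
      rw [(Set.mem_insert_iff.1 hmem).resolve_right h.1]
    · exact absurd (h1 ▸ Set.mem_insert m (cl C)) h.1
    · exact absurd (h1 ▸ Set.mem_insert m' (cl C)) h'.1
    · rw [h2]

open Finset in
/-- For a Moore family `L` and a proper subset `r` of a finite set, there is a point `m ∉ r` such
that merging the sets that differ in `m` only leaves at least half as many sets as there are in
`L ∪ {B ∩ r | B ∈ L}`. -/
theorem exists_card_union_le_two_mul_card_image {α : Type*} [Finite α] [DecidableEq (Set α)]
    (L : Finset (Set α)) (hL : ∀ S : Set (Set α), S ⊆ L → ⋂₀ S ∈ L) {r : Set α}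
    (hr : r ≠ Set.univ) :
    ∃ m ∉ r, #(L ∪ L.image (· ∩ r)) ≤ 2 * #(L.image (· \ {m})) := by
  classical
  have := Fintype.ofFinite α
  let W : Finset α := {a | a ∉ r}
  have hW : ∀ a, a ∈ W ↔ a ∉ r := by simp [W]
  obtain ⟨a, ha⟩ := (Set.ne_univ_iff_exists_notMem r).1 hr
  let Y := L.image (· ∩ r) \ L
  let U : α → Finset (Set α) := fun m => {B ∈ L | symmDiff B {m} ∉ L}
  have hcard : #{p ∈ L ×ˢ W | symmDiff p.1 {p.2} ∉ L} = ∑ m ∈ W, #(U m) := by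
    rw [Finset.card_filter, Finset.sum_product_right]
    simp only [U, Finset.card_filter]
  have hsum : ∑ m ∈ W, #Y ≤ ∑ m ∈ W, #(U m) := by
    rw [Finset.sum_const, smul_eq_mul, mul_comm, ← hcard]
    refine card_mul_card_le_card_unmatched L Y W r hW hL fun C hC => ?_
    obtain ⟨h1, h2⟩ := Finset.mem_sdiff.1 hC
    exact ⟨h2, Finset.mem_image.1 h1⟩
  obtain ⟨m, hm, hle⟩ := Finset.exists_le_of_sum_le ⟨a, (hW a).2 ha⟩ hsum
  refine ⟨m, (hW m).1 hm, ?_⟩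
  -- Adding the partners of the unmatched sets to `L` gives a disjoint union, all of whose
  -- members arise from some `B \ {m}` by possibly inserting `m`.
  have toggle : Function.Involutive fun B : Set α => symmDiff B {m} :=
    fun B => symmDiff_symmDiff_cancel_right _ _
  have hdisj : Disjoint L ((U m).image fun B => symmDiff B {m}) := by
    refine Finset.disjoint_left.2 fun B hB hB' => ?_
    obtain ⟨B', hU, rfl⟩ := Finset.mem_image.1 hB'
    exact (Finset.mem_filter.1 hU).2 hB
  have hsub : L ∪ (U m).image (fun B => symmDiff B {m}) ⊆
      L.image (· \ {m}) ∪ (L.image (· \ {m})).image (insert m) := by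
    have aux : ∀ D B : Set α, B ∈ L → D \ {m} = B \ {m} →
        D ∈ L.image (· \ {m}) ∪ (L.image (· \ {m})).image (insert m) := by
      intro D B hB h
      by_cases hmD : m ∈ D
      · refine Finset.mem_union_right _ (Finset.mem_image.2 ⟨_, Finset.mem_image_of_mem _ hB, ?_⟩)
        rw [← h, Set.insert_sdiff_singleton, Set.insert_eq_of_mem hmD]
      · refine Finset.mem_union_left _ (Finset.mem_image.2 ⟨B, hB, ?_⟩)
        rw [← h, Set.sdiff_singleton_eq_self hmD]
    refine Finset.union_subset (fun B hB => aux B B hB rfl) fun D hD => ?_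
    obtain ⟨B, hB, rfl⟩ := Finset.mem_image.1 hD
    refine aux _ B (Finset.mem_filter.1 hB).1 ?_
    ext x
    by_cases hx : x = m <;> simp [hx]
  calc #(L ∪ L.image (· ∩ r)) = #L + #Y := by
        rw [← Finset.union_sdiff_self_eq_union, Finset.card_union_of_disjoint Finset.disjoint_sdiff]
    _ ≤ #L + #((U m).image fun B => symmDiff B {m}) := by
      rw [Finset.card_image_of_injective _ toggle.injective]
      exact Nat.add_le_add_left hle _
    _ = #(L ∪ (U m).image fun B => symmDiff B {m}) := (Finset.card_union_of_disjoint hdisj).symm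
    _ ≤ #(L.image (· \ {m})) + #((L.image (· \ {m})).image (insert m)) :=
      (Finset.card_le_card hsub).trans (Finset.card_union_le _ _)
    _ ≤ 2 * #(L.image (· \ {m})) := by
      rw [two_mul]
      exact Nat.add_le_add_left Finset.card_image_le _

/-! ### The number of concepts -/

namespace FormalContext

theorem numConcepts_eq_ncard (K : FormalContext.{u, v}) :
    K.numConcepts = (Set.range (upperPolar K.Inc)).ncard := by
  have : Set.range (upperPolar K.Inc) = Set.range (Concept.intent : Concept K.Obj K.Att K.Inc → _) := by
    ext B
    exact Concept.isIntent_iff_exists_concept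
  rw [this, ← Nat.card_coe_set_eq, Nat.card_range_of_injective Concept.intent_injective]
  rfl

theorem numConcepts_le (K : FormalContext.{u, v}) [Finite K.Att] :
    K.numConcepts ≤ 2 ^ Nat.card K.Att := by
  rw [numConcepts_eq_ncard]
  refine (Set.ncard_le_ncard (Set.subset_univ _)).trans ?_
  have := Fintype.ofFinite K.Att
  rw [Set.ncard_univ, Nat.card_eq_fintype_card, Nat.card_eq_fintype_card, Fintype.card_set]

theorem numConcepts_pos (K : FormalContext.{u, v}) [Finite K.Att] : 0 < K.numConcepts := by
  rw [numConcepts_eq_ncard]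
  exact (Set.ncard_pos).2 (Set.range_nonempty _)

theorem image_val_upperPolar_sub (K : FormalContext.{u, v}) (H : Set K.Obj) (N : Set K.Att)
    (A : Set H) :
    ((↑) : N → K.Att) '' upperPolar (K.sub H N).Inc A =
      upperPolar K.Inc (((↑) : H → K.Obj) '' A) ∩ N := by
  ext m
  constructor
  · rintro ⟨m, hm, rfl⟩
    refine ⟨?_, m.2⟩
    rintro _ ⟨g, hg, rfl⟩
    exact hm hg
  · rintro ⟨hm, hN⟩
    exact ⟨⟨m, hN⟩, fun g hg => hm (Set.mem_image_of_mem _ hg), rfl⟩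

/-- Some object and some attribute can be removed at the cost of at most half of the concepts. -/
theorem exists_numConcepts_le_two_mul_sub (K : FormalContext.{u, v}) [Finite K.Att]
    [Nonempty K.Obj] [Nonempty K.Att] :
    ∃ g m, K.numConcepts ≤ 2 * (K.sub {g}ᶜ {m}ᶜ).numConcepts := by
  classical
  -- If incidence is total, there is one concept only; otherwise remove an object `g` whose
  -- attributes form a proper subset.
  by_cases hfull : ∀ g m, K.Inc g m
  · obtain ⟨g⟩ := ‹Nonempty K.Obj›
    obtain ⟨m⟩ := ‹Nonempty K.Att›
    refine ⟨g, m, ?_⟩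
    have h1 : K.numConcepts ≤ 1 := by
      rw [numConcepts_eq_ncard, ← Set.ncard_singleton (Set.univ : Set K.Att)]
      refine Set.ncard_le_ncard ?_
      rintro _ ⟨A, rfl⟩
      exact Set.eq_univ_of_forall fun m g _ => hfull g m
    have : Finite (K.sub {g}ᶜ {m}ᶜ).Att := inferInstanceAs (Finite ({m}ᶜ : Set K.Att))
    have h2 := (K.sub {g}ᶜ {m}ᶜ).numConcepts_pos
    lia
  · push Not at hfull
    obtain ⟨g, m₀, hg⟩ := hfull
    let r : Set K.Att := {m | K.Inc g m}
    -- `L` consists of the intents of the context without the object `g`.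
    let L : Finset (Set K.Att) := (Set.toFinite (upperPolar K.Inc '' {A | g ∉ A})).toFinset
    have mem_L : ∀ B, B ∈ L ↔ ∃ A, g ∉ A ∧ upperPolar K.Inc A = B := fun B =>
      Set.Finite.mem_toFinset _
    have hL : ∀ S : Set (Set K.Att), S ⊆ L → ⋂₀ S ∈ L := by
      intro S hS
      refine (mem_L _).2 ⟨⋃₀ {A | g ∉ A ∧ upperPolar K.Inc A ∈ S}, ?_, ?_⟩
      · rintro ⟨A, hA, hgA⟩
        exact hA.1 hgA
      · ext m
        constructor
        · intro hm B hB
          obtain ⟨A, hA, rfl⟩ := (mem_L B).1 (hS hB)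
          exact fun a ha => hm ⟨A, ⟨hA, hB⟩, ha⟩
        · rintro hm a ⟨A, hA, ha⟩
          exact hm _ hA.2 ha
    obtain ⟨m, -, hm⟩ := exists_card_union_le_two_mul_card_image L hL
      ((Set.ne_univ_iff_exists_notMem r).2 ⟨m₀, hg⟩)
    refine ⟨g, m, ?_⟩
    have h1 : K.numConcepts ≤ (L ∪ L.image (· ∩ r)).card := by
      rw [numConcepts_eq_ncard, ← Set.ncard_coe_finset]
      refine Set.ncard_le_ncard ?_
      rintro _ ⟨A, rfl⟩
      rw [Finset.mem_coe, Finset.mem_union, Finset.mem_image]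
      by_cases hgA : g ∈ A
      · refine Or.inr ⟨_, (mem_L _).2 ⟨A \ {g}, by simp, rfl⟩, ?_⟩
        have hr : r = upperPolar K.Inc {g} := by
          ext m
          simp [r]
        rw [hr, ← upperPolar_union, Set.sdiff_union_of_subset (Set.singleton_subset_iff.2 hgA)]
      · exact Or.inl ((mem_L _).2 ⟨A, hgA, rfl⟩)
    have : Finite (K.sub {g}ᶜ {m}ᶜ).Att := inferInstanceAs (Finite ({m}ᶜ : Set K.Att))
    have h2 : (L.image (· \ {m})).card ≤ (K.sub {g}ᶜ {m}ᶜ).numConcepts := by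
      rw [numConcepts_eq_ncard, ← Set.ncard_coe_finset]
      refine (Set.ncard_le_ncard (t := Set.image ((↑) : ({m}ᶜ : Set K.Att) → K.Att) ''
        Set.range (upperPolar (K.sub {g}ᶜ {m}ᶜ).Inc)) ?_).trans
        (Set.ncard_image_le (Set.toFinite _))
      intro D hD
      obtain ⟨B, hB, rfl⟩ := Finset.mem_image.1 (Finset.mem_coe.1 hD)
      obtain ⟨A, hA, rfl⟩ := (mem_L B).1 hB
      refine ⟨_, ⟨((↑) : ({g}ᶜ : Set K.Obj) → K.Obj) ⁻¹' A, rfl⟩, ?_⟩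
      have hAg : A ⊆ {g}ᶜ := fun a ha h => hA (Set.mem_singleton_iff.1 h ▸ ha)
      have hA' : ((↑) : ({g}ᶜ : Set K.Obj) → K.Obj) '' ((↑) ⁻¹' A) = A := by
        rw [Subtype.image_preimage_coe, Set.inter_eq_right.2 hAg]
      exact (image_val_upperPolar_sub K _ _ _).trans
        (congrArg (fun A => upperPolar K.Inc A ∩ {m}ᶜ) hA')
    lia

/-! ### Contranominal scales -/

/-- A contranominal scale is given by two families, of objects and of attributes, such that
incidence is inequality of the indices; these families are necessarily injective. -/
theorem hasContranominal_iff {K : FormalContext.{u, v}} {j : ℕ} :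
    K.HasContranominal j ↔
      ∃ (f : Fin j → K.Obj) (h : Fin j → K.Att), ∀ a b, K.Inc (f a) (h b) ↔ a ≠ b := by
  constructor
  · rintro ⟨H, N, ⟨e⟩⟩
    refine ⟨fun a => (e.objEquiv.symm a).1, fun b => (e.attEquiv.symm b).1, fun a b => ?_⟩
    refine (e.inc_iff (e.objEquiv.symm a) (e.attEquiv.symm b)).trans ?_
    exact Iff.of_eq (congrArg₂ (contranominal j).Inc (e.objEquiv.apply_symm_apply a)
      (e.attEquiv.apply_symm_apply b))
  · rintro ⟨f, h, hfh⟩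
    have hf : Function.Injective f := fun a b hab => by
      by_contra hne
      exact (hfh b b).1 (hab ▸ (hfh a b).2 hne) rfl
    have hh : Function.Injective h := fun a b hab => by
      by_contra hne
      exact (hfh a a).1 (hab ▸ (hfh a b).2 hne) rfl
    refine ⟨Set.range f, Set.range h, ⟨⟨(Equiv.ofInjective f hf).symm,
      (Equiv.ofInjective h hh).symm, ?_⟩⟩⟩
    rintro ⟨_, a, rfl⟩ ⟨_, b, rfl⟩
    exact (hfh a b).trans (Iff.of_eq (congrArg₂ (contranominal j).Inc
      (Equiv.ofInjective_symm_apply hf a).symm (Equiv.ofInjective_symm_apply hh b).symm))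

theorem hasContranominal_zero (K : FormalContext.{u, v}) : K.HasContranominal 0 :=
  hasContranominal_iff.2 ⟨Fin.elim0, Fin.elim0, fun a => a.elim0⟩

theorem HasContranominal.of_sub {K : FormalContext.{u, v}} {H : Set K.Obj} {N : Set K.Att} {j : ℕ}
    (h : (K.sub H N).HasContranominal j) : K.HasContranominal j := by
  obtain ⟨f, h, hfh⟩ := hasContranominal_iff.1 h
  exact hasContranominal_iff.2 ⟨fun a => (f a).1, fun b => (h b).1, hfh⟩

/-! ### The direct sum with the contranominal scale of size one -/

/-- The direct sum of a context with the contranominal scale of size one: a new object and a new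
attribute, both denoted by `none`, are added. They are not incident with each other, but each is
incident with everything else. -/
def extend (K : FormalContext.{u, v}) : FormalContext.{u, v} where
  Obj := Option K.Obj
  Att := Option K.Att
  Inc
    | none, none => False
    | none, some _ => True
    | some _, none => True
    | some g, some m => K.Inc g m

theorem two_mul_numConcepts_le_extend (K : FormalContext.{u, v}) [Finite K.Att] :
    2 * K.numConcepts ≤ K.extend.numConcepts := by
  have : Finite K.extend.Att := inferInstanceAs (Finite (Option K.Att))
  let S := Set.range (upperPolar K.Inc)
  let i : Set K.Att → Set (Option K.Att) := fun B => some '' B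
  have hi : Function.Injective i := Set.image_injective.2 (Option.some_injective _)
  let k : Set K.Att → Set (Option K.Att) := fun B => insert none (some '' B)
  have none_notMem : ∀ B, none ∉ i B := by simp [i]
  have hk : Function.Injective k := fun B C h => by
    refine hi ?_
    rw [← Set.insert_sdiff_self_of_notMem (none_notMem B),
      ← Set.insert_sdiff_self_of_notMem (none_notMem C)]
    exact congrArg (· \ {none}) h
  have hdisj : Disjoint (i '' S) (k '' S) := by
    refine Set.disjoint_left.2 ?_
    rintro _ ⟨B, -, rfl⟩ ⟨C, -, hC⟩
    exact none_notMem B (hC ▸ Set.mem_insert _ _)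
  have hsub : i '' S ∪ k '' S ⊆ Set.range (upperPolar K.extend.Inc) := by
    rintro _ (⟨_, ⟨A, rfl⟩, rfl⟩ | ⟨_, ⟨A, rfl⟩, rfl⟩)
    · refine ⟨insert none (some '' A), ?_⟩
      ext (_ | m)
      · exact iff_of_false (fun h => h (Set.mem_insert none _)) (none_notMem _)
      · rw [(Option.some_injective _).mem_set_image]
        refine ⟨fun h g hg => h (Set.mem_insert_of_mem none ⟨g, hg, rfl⟩), ?_⟩
        rintro h _ (rfl | ⟨g, hg, rfl⟩)
        exacts [trivial, h hg]
    · refine ⟨some '' A, ?_⟩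
      ext (_ | m)
      · simp [k, mem_upperPolar_iff, extend]
      · simp [k, mem_upperPolar_iff, extend]
  calc 2 * K.numConcepts = (i '' S).ncard + (k '' S).ncard := by
        rw [Set.ncard_image_of_injective _ hi, Set.ncard_image_of_injective _ hk, two_mul,
          numConcepts_eq_ncard]
    _ = (i '' S ∪ k '' S).ncard := (Set.ncard_union_eq hdisj).symm
    _ ≤ K.extend.numConcepts := by
        rw [numConcepts_eq_ncard]
        exact Set.ncard_le_ncard hsub

theorem hasContranominal_extend_succ_iff {K : FormalContext.{u, v}} {j : ℕ} :
    K.extend.HasContranominal (j + 1) ↔ K.HasContranominal j := by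
  simp only [hasContranominal_iff]
  constructor
  · rintro ⟨f, h, hfh⟩
    -- The object `none` and the attribute `none` can occur at one common index only: discard it.
    have h_none : ∀ b, h b = none → f b = none := by
      intro b hb
      have hinc := mt (hfh b b).1 (not_not.2 rfl)
      rw [hb] at hinc
      cases hf : f b with
      | none => rfl
      | some g => exact absurd (hf ▸ trivial) hinc
    obtain ⟨a, ha⟩ : ∃ a, ∀ b, f b = none → b = a := by
      by_cases hex : ∃ a, f a = none
      · obtain ⟨a, ha⟩ := hex
        refine ⟨a, fun b hb => ?_⟩
        by_contra hne
        have hinc := (hfh b a).2 hne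
        rw [hb, ← ha] at hinc
        exact (hfh a a).1 hinc rfl
      · exact ⟨0, fun b hb => absurd ⟨b, hb⟩ hex⟩
    have hf : ∀ b : Fin j, ∃ g, f (a.succAbove b) = some g := fun b =>
      Option.ne_none_iff_exists'.1 fun hb => Fin.succAbove_ne a b (ha _ hb)
    have hh : ∀ b : Fin j, ∃ m, h (a.succAbove b) = some m := fun b =>
      Option.ne_none_iff_exists'.1 fun hb => Fin.succAbove_ne a b (ha _ (h_none _ hb))
    choose f' hf' using hf
    choose h' hh' using hh
    refine ⟨f', h', fun b c => ?_⟩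
    have := hfh (a.succAbove b) (a.succAbove c)
    rw [hf', hh', (Fin.succAbove_right_injective).ne_iff] at this
    exact this
  · rintro ⟨f, h, hfh⟩
    refine ⟨Fin.cons none fun a => some (f a), Fin.cons none fun b => some (h b), fun a b => ?_⟩
    cases a using Fin.cases <;> cases b using Fin.cases
    · simp [extend]
    · simp [extend, (Fin.succ_ne_zero _).symm]
    · simp [extend]
    · simpa [extend] using hfh _ _

/-! ### Extremal contexts -/

theorem extend_mem_contranominalFree {K : FormalContext.{u, v}} {n m c : ℕ}
    (hK : K ∈ contranominalFree n m c) : K.extend ∈ contranominalFree (n + 1) (m + 1) (c + 1) := by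
  obtain ⟨⟨hO, rfl⟩, ⟨hA, rfl⟩, hc⟩ := hK
  exact ⟨⟨inferInstanceAs (Finite (Option K.Obj)), Finite.card_option⟩,
    ⟨inferInstanceAs (Finite (Option K.Att)), Finite.card_option⟩,
    mt hasContranominal_extend_succ_iff.1 hc⟩

theorem sub_mem_contranominalFree {K : FormalContext.{u, v}} {n m c : ℕ}
    (hK : K ∈ contranominalFree (n + 1) (m + 1) c) (g : K.Obj) (b : K.Att) :
    K.sub {g}ᶜ {b}ᶜ ∈ contranominalFree n m c := by
  obtain ⟨⟨hO, hn⟩, ⟨hA, hm⟩, hc⟩ := hK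
  refine ⟨⟨inferInstanceAs (Finite ({g}ᶜ : Set K.Obj)), ?_⟩,
    ⟨inferInstanceAs (Finite ({b}ᶜ : Set K.Att)), ?_⟩, mt HasContranominal.of_sub hc⟩
  · change Nat.card ({g}ᶜ : Set K.Obj) = n
    rw [Nat.card_coe_set_eq, Set.ncard_compl, Set.ncard_singleton, hn, Nat.add_sub_cancel]
  · change Nat.card ({b}ᶜ : Set K.Att) = m
    rw [Nat.card_coe_set_eq, Set.ncard_compl, Set.ncard_singleton, hm, Nat.add_sub_cancel]

theorem extremal_nonempty (n m c : ℕ) : (extremal.{u, v} n m (c + 1)).Nonempty := by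
  -- Where every object has every attribute, there is no contranominal scale of positive size.
  let K : FormalContext.{u, v} := ⟨ULift (Fin n), ULift (Fin m), fun _ _ => True⟩
  have hK : K ∈ contranominalFree n m (c + 1) := by
    refine ⟨⟨inferInstanceAs (Finite (ULift (Fin n))), by simp [K]⟩,
      ⟨inferInstanceAs (Finite (ULift (Fin m))), by simp [K]⟩, fun h => ?_⟩
    obtain ⟨f, h, hfh⟩ := hasContranominal_iff.1 h
    exact (hfh 0 0).1 trivial rfl
  have hbdd : BddAbove (numConcepts '' contranominalFree.{u, v} n m (c + 1)) := by
    refine ⟨2 ^ m, ?_⟩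
    rintro _ ⟨L, ⟨-, ⟨hfin, rfl⟩, -⟩, rfl⟩
    exact L.numConcepts_le
  obtain ⟨L, hL, hmax⟩ := Nat.sSup_mem ⟨_, Set.mem_image_of_mem numConcepts hK⟩ hbdd
  exact ⟨L, hL, fun L' hL' => hmax ▸ le_csSup hbdd (Set.mem_image_of_mem numConcepts hL')⟩

/-- If `K` has no contranominal scale of size `c`, and `K₀` is extremal among the contexts
with one object and one attribute fewer and without such a scale, then `K₀.extend` has at least as
many concepts as `K`. -/
theorem numConcepts_le_extend {K K₀ : FormalContext.{u, v}} {n m c : ℕ}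
    (hK : K ∈ contranominalFree (n + 1) (m + 1) c) (hK₀ : K₀ ∈ extremal.{u, v} n m c) :
    K.numConcepts ≤ K₀.extend.numConcepts := by
  obtain ⟨⟨-, hn⟩, ⟨_, hm⟩, -⟩ := id hK
  have : Nonempty K.Obj := (Nat.card_pos_iff.1 (hn ▸ n.succ_pos)).1
  have : Nonempty K.Att := (Nat.card_pos_iff.1 (hm ▸ m.succ_pos)).1
  have : Finite K₀.Att := hK₀.1.2.1.1
  obtain ⟨g, b, hgb⟩ := K.exists_numConcepts_le_two_mul_sub
  calc K.numConcepts ≤ 2 * (K.sub {g}ᶜ {b}ᶜ).numConcepts := hgb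
    _ ≤ 2 * K₀.numConcepts := Nat.mul_le_mul_left 2 (hK₀.2 _ (sub_mem_contranominalFree hK g b))
    _ ≤ K₀.extend.numConcepts := K₀.two_mul_numConcepts_le_extend

end FormalContext

open FormalContext in
theorem mainTheorem2 (n m c : ℕ) (hc_pos : 1 ≤ c) (hc : c ≤ min n m + 1) :
    ∃ K ∈ FormalContext.extremal.{u, v} n m c, K.HasContranominal (c - 1) := by
  obtain ⟨k, rfl⟩ := Nat.exists_eq_add_of_le' hc_pos
  rw [Nat.add_sub_cancel]
  induction k generalizing n m with
  | zero =>
    obtain ⟨K, hK⟩ := extremal_nonempty.{u, v} n m 0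
    exact ⟨K, hK, K.hasContranominal_zero⟩
  | succ k ih =>
    obtain ⟨n, rfl⟩ := Nat.exists_eq_add_of_le' (show 1 ≤ n by lia)
    obtain ⟨m, rfl⟩ := Nat.exists_eq_add_of_le' (show 1 ≤ m by lia)
    obtain ⟨K, hK⟩ := extremal_nonempty.{u, v} (n + 1) (m + 1) (k + 1)
    by_cases hscale : K.HasContranominal (k + 1)
    · exact ⟨K, hK, hscale⟩
    · obtain ⟨K₀, hK₀, hscale₀⟩ := ih n m (by lia) (by lia)
      refine ⟨K₀.extend, ⟨extend_mem_contranominalFree hK₀.1, fun L hL => (hK.2 L hL).trans ?_⟩,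
        hasContranominal_extend_succ_iff.2 hscale₀⟩
      exact numConcepts_le_extend ⟨hK.1.1, hK.1.2.1, hscale⟩ hK₀
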